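/- Let $L$ be a Lie algebra over a field $K$ of characteristic zero (of arbitrary, possibly infinite, dimension), and suppose that $L$ carries a first-order structure, in a language $\mathcal{L}$ expanding the language $\{0,+,-,[\cdot,\cdot]\}$ of Lie rings, which expands the Lie ring structure of $L$ and is stable (no formula has the order property in a model of the complete theory of this structure). For example, $\mathcal{L}$ may be the language of Lie rings itself, or may contain in addition a unary function symbol for multiplication by each scalar. Let $$F(L)=\sum\{I : I \text{ is an ideal of } L \text{ that is nilpotent as a Lie algebra}\}$$ be the Fitting ideal of $L$. Then $F(L)$ is nilpotent (as a Lie algebra), and $F(L)$ is a definable subset of $L$, i.e. it is defined by an $\mathcal{L}$-formula with parameters in $L$. -/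

import Mathlib

/-- The function symbols `0`, `+`, `-` and `[ , ]` of the language of Lie rings. -/
inductive LieRingFunc : ℕ → Type
  | zero : LieRingFunc 0
  | neg : LieRingFunc 1
  | add : LieRingFunc 2
  | bracket : LieRingFunc 2

/-- The first-order language of Lie rings. -/
def FirstOrder.Language.lieRing : FirstOrder.Language.{0, 0} where
  Functions := LieRingFunc
  Relations := fun _ => Empty

/-- A Lie ring, regarded as a first-order structure in the language of Lie rings. -/
instance LieRing.lieRingStructure (L : Type*) [LieRing L] :
    FirstOrder.Language.lieRing.Structure L where
  funMap := fun {n} (f : LieRingFunc n) =>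
    match n, f with
    | _, .zero => fun _ => 0
    | _, .neg => fun x => -x 0
    | _, .add => fun x => x 0 + x 1
    | _, .bracket => fun x => ⁅x 0, x 1⁆
  RelMap := fun {_} r _ => nomatch r

/-- The formula `φ(x; y)` has a ladder of length `k` in `M`: there are tuples `a i`, `b j` of `M`,
for `i, j < k`, with `M ⊨ φ(a i; b j)` if and only if `i < j`. -/
def FirstOrder.Language.HasLadder {𝓛 : FirstOrder.Language} (M : Type*) [𝓛.Structure M]
    {m n : ℕ} (φ : 𝓛.Formula (Fin m ⊕ Fin n)) (k : ℕ) : Prop :=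
  ∃ (a : Fin k → Fin m → M) (b : Fin k → Fin n → M),
    ∀ i j, φ.Realize (Sum.elim (a i) (b j)) ↔ i < j

/-- The structure `M` is stable: every formula `φ(x; y)`, in two finite tuples of variables, has
ladders of bounded length only. The absence of a ladder of a given length is a first-order
sentence, so this is a property of the complete theory of `M`; by compactness it says that no
formula has the order property (an infinite ladder) in a model of this theory. -/
def FirstOrder.Language.IsStable (𝓛 : FirstOrder.Language) (M : Type*) [𝓛.Structure M] : Prop :=
  ∀ (m n : ℕ) (φ : 𝓛.Formula (Fin m ⊕ Fin n)), ∃ k : ℕ, ¬ FirstOrder.Language.HasLadder M φ k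

/-- The Fitting ideal: the sum of all ideals that are nilpotent as Lie algebras in their own
right. (Mathlib's `LieAlgebra.maxNilpotentIdeal` is a different object: it is made from the ideals
that are nilpotent as modules over the whole of `L`.) -/
def LieAlgebra.fittingIdeal (K L : Type*) [CommRing K] [LieRing L] [LieAlgebra K L] :
    LieIdeal K L :=
  sSup {I : LieIdeal K L | LieRing.IsNilpotent I}

/-! Stability gives the Baldwin–Saxl chain condition: intersections of annihilators of left-normed
lists of a fixed length satisfy the descending chain condition and reduce to finite ones. An ideal
is nilpotent iff it acts nilpotently on `L`, and sums of two such ideals are again such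
(`ActsNilpotently.sup`), so finite subsets of F = F(L) lie in nilpotent ideals.

If F is not nilpotent, take an ideal X with G = F ∩ C(X) not nilpotent and C(X) minimal. Then G is
nonabelian and contains an ideal A, not centralised by G, with [A, G, G] = 0
(`exists_ideal_le_upper_two`). By minimality H = F ∩ C(X + A) is nilpotent, and the Jacobi identity
puts [G, G] in H. So G acts by commuting operators on each factor of the upper central series of H
in L, and a nilpotent J ≤ G with the same annihilator there forces G to act nilpotently
(`ActsNilpotently.of_lie_le`), a contradiction.

Once nilpotent, F consists of the x with [x, Zᵢ₊₁] ⊆ Zᵢ for all i < n, where Zᵢ is its upper central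
series in L; by the chain condition each inclusion is a finite conjunction of equations. -/

open FirstOrder

/-! ### Chain conditions for uniform families of subgroups -/

section ChainCondition

variable {A Y : Type*} [AddCommGroup A]

/-- A family of subgroups without a ladder of length `k` has no irredundant finite
intersection of `k` members. -/
theorem AddSubgroup.exists_subset_card_lt_iInf_le (S : Y → AddSubgroup A) {k : ℕ}
    (hk : ¬ ∃ (a : Fin k → A) (b : Fin k → Y), ∀ i j, a i ∈ S (b j) ↔ i < j) (B : Finset Y) :
    ∃ B₀ ⊆ B, B₀.card < k ∧ ⨅ y ∈ B₀, S y ≤ ⨅ y ∈ B, S y := by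
  classical
  induction B using Finset.strongInduction with
  | H B ih =>
    by_cases hB : B.card < k
    · exact ⟨B, subset_rfl, hB, le_rfl⟩
    by_cases hred : ∃ y ∈ B, ⨅ z ∈ B.erase y, S z ≤ S y
    · obtain ⟨y, hy, hle⟩ := hred
      obtain ⟨B₀, h₀, hc, h⟩ := ih _ (Finset.erase_ssubset hy)
      refine ⟨B₀, h₀.trans (Finset.erase_subset _ _), hc, h.trans ?_⟩
      refine le_iInf₂ fun z hz => ?_
      by_cases hzy : z = y
      · exact hzy ▸ hle
      · exact iInf₂_le z (Finset.mem_erase.2 ⟨hzy, hz⟩)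
    · exfalso
      push Not at hred hB
      have hex : ∀ y ∈ B, ∃ a, (∀ z ∈ B, z ≠ y → a ∈ S z) ∧ a ∉ S y := by
        intro y hy
        obtain ⟨a, ha, hay⟩ := SetLike.not_le_iff_exists.1 (hred y hy)
        refine ⟨a, fun z hz hzy => ?_, hay⟩
        simp only [AddSubgroup.mem_iInf] at ha
        exact ha z (Finset.mem_erase.2 ⟨hzy, hz⟩)
      choose! a ha ha' using hex
      obtain ⟨b, hb⟩ : ∃ b : Fin k → Y, Function.Injective b ∧ ∀ i, b i ∈ B := by
        refine ⟨fun i => (B.equivFin.symm (Fin.castLE hB i) : Y), ?_, fun i => Subtype.coe_prop _⟩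
        exact Subtype.val_injective.comp
          (B.equivFin.symm.injective.comp (Fin.castLE_injective hB))
      -- Only the `j`-th summand is outside `S (b j)`, and it occurs exactly when `j ≤ i`.
      refine hk ⟨fun i => ∑ j ∈ Finset.Iic i, a (b j), b, fun i j => ?_⟩
      have hoff : ∀ l, l ≠ j → a (b l) ∈ S (b j) := fun l hl =>
        ha _ (hb.2 l) _ (hb.2 j) (fun h => hl (hb.1 h).symm)
      constructor
      · intro hmem
        by_contra hij
        have hj : j ∈ Finset.Iic i := Finset.mem_Iic.2 (not_lt.1 hij)
        simp only [← Finset.add_sum_erase _ _ hj] at hmem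
        refine ha' _ (hb.2 j) ((AddSubgroup.add_mem_cancel_right _ ?_).1 hmem)
        exact sum_mem fun l hl => hoff l (Finset.ne_of_mem_erase hl)
      · intro hij
        exact sum_mem fun l hl => hoff l ((Finset.mem_Iic.1 hl).trans_lt hij).ne

/-- The Baldwin–Saxl chain condition, for finite intersections. -/
theorem AddSubgroup.wellFounded_iInf_finset (S : Y → AddSubgroup A)
    (h₁ : ∃ k, ¬ ∃ (a : Fin k → A) (b : Fin k → Y), ∀ i j, a i ∈ S (b j) ↔ i < j)
    (h₂ : ∀ k, ∃ m, ¬ ∃ (a : Fin m → A) (c : Fin m → Fin k → Y),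
      ∀ i j, (¬ ∀ r, a i ∈ S (c j r)) ↔ i < j) :
    WellFounded fun B B' : Finset Y => ⨅ y ∈ B, S y < ⨅ y ∈ B', S y := by
  classical
  obtain ⟨k, hk⟩ := h₁
  obtain ⟨m, hm⟩ := h₂ k
  rw [wellFounded_iff_isEmpty_descending_chain]
  refine ⟨fun ⟨f, hf⟩ => hm ?_⟩
  have hanti : StrictAnti fun i => ⨅ y ∈ f i, S y := strictAnti_nat_of_succ_lt hf
  have hrep : ∀ i, ∃ c : Fin k → Y, ∀ x, (∀ r, x ∈ S (c r)) ↔ x ∈ ⨅ y ∈ f (i + 1), S y := by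
    intro i
    obtain ⟨B₀, hsub, hcard, hle⟩ := exists_subset_card_lt_iInf_le S hk (f (i + 1))
    -- The shift to `f (i + 1)` makes the intersection proper, so `B₀` is nonempty and can be padded
    -- to a `k`-tuple by repetition.
    have hne : B₀.Nonempty := by
      rw [Finset.nonempty_iff_ne_empty]
      rintro rfl
      simp only [Finset.notMem_empty, iInf_false, iInf_top, top_le_iff] at hle
      exact not_top_lt (hle ▸ hf i)
    have : Nonempty B₀ := hne.to_subtype
    let e : ↥B₀ → Fin k := fun y => Fin.castLE hcard.le (B₀.equivFin y)
    have he : Function.Injective e := (Fin.castLE_injective _).comp B₀.equivFin.injective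
    refine ⟨fun r => ((Function.invFun e r : ↥B₀) : Y), fun x => ⟨fun h => hle ?_, fun h r => ?_⟩⟩
    · simp only [AddSubgroup.mem_iInf]
      intro y hy
      simpa [Function.leftInverse_invFun he ⟨y, hy⟩] using h (e ⟨y, hy⟩)
    · simp only [AddSubgroup.mem_iInf] at h
      exact h _ (hsub (Subtype.coe_prop _))
  choose c hc using hrep
  have hex : ∀ i, ∃ x, x ∈ ⨅ y ∈ f (i + 1), S y ∧ x ∉ ⨅ y ∈ f (i + 2), S y := fun i => by
    obtain ⟨x, hx, hx'⟩ := SetLike.exists_of_lt (hf (i + 1))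
    exact ⟨x, hx, hx'⟩
  choose a ha ha' using hex
  refine ⟨fun i => a i, fun i => c i, fun i j => ?_⟩
  rw [hc, Fin.lt_def]
  constructor
  · intro h
    by_contra hij
    exact h (hanti.antitone (by lia : (j : ℕ) + 1 ≤ i + 1) (ha i))
  · intro hij h
    exact ha' i (hanti.antitone (by lia : (i : ℕ) + 2 ≤ j + 1) h)

/-- A minimal finite intersection over `T` is cut no further by any member of `T`. -/
theorem AddSubgroup.exists_finset_iInf_eq {S : Y → AddSubgroup A}
    (h : WellFounded fun B B' : Finset Y => ⨅ y ∈ B, S y < ⨅ y ∈ B', S y) (T : Set Y) :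
    ∃ B : Finset Y, ↑B ⊆ T ∧ ⨅ y ∈ B, S y = ⨅ y ∈ T, S y := by
  classical
  obtain ⟨B, hB, hmin⟩ := h.has_min {B : Finset Y | ↑B ⊆ T} ⟨∅, by simp⟩
  refine ⟨B, hB, le_antisymm (le_iInf₂ fun y hy => ?_) (biInf_mono hB)⟩
  by_contra hle
  refine hmin (insert y B) ?_ (lt_of_le_of_ne ?_ fun heq => hle ?_)
  · simpa [Set.insert_subset_iff] using ⟨hy, hB⟩
  · exact biInf_mono fun z hz => Finset.mem_insert_of_mem hz
  · exact heq ▸ iInf₂_le y (Finset.mem_insert_self y B)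

theorem AddSubgroup.exists_minimal_iInf {S : Y → AddSubgroup A}
    (h : WellFounded fun B B' : Finset Y => ⨅ y ∈ B, S y < ⨅ y ∈ B', S y)
    {ι : Type*} [Nonempty ι] (T : ι → Set Y) :
    ∃ i, ∀ j, ¬ ⨅ y ∈ T j, S y < ⨅ y ∈ T i, S y := by
  choose B _ hB using fun i => exists_finset_iInf_eq h (T i)
  obtain ⟨_, ⟨i, rfl⟩, hi⟩ := h.has_min (Set.range B) (Set.range_nonempty B)
  exact ⟨i, fun j hj => hi (B j) ⟨j, rfl⟩ (by rwa [hB, hB])⟩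

end ChainCondition

/-! ### Annihilators in stable Lie rings -/

section Stability

/-- The left-normed bracket `[[[x, y₁], y₂], …, yₙ]`. -/
def LieRing.leftNormed {L : Type*} [LieRing L] (x : L) (l : List L) : L :=
  l.foldl (fun u v => ⁅u, v⁆) x

open LieRing

@[simp] theorem LieRing.leftNormed_nil {L : Type*} [LieRing L] (x : L) :
    leftNormed x [] = x := rfl

@[simp] theorem LieRing.leftNormed_cons {L : Type*} [LieRing L] (x y : L) (l : List L) :
    leftNormed x (y :: l) = leftNormed ⁅x, y⁆ l := rfl

/-- The left-normed bracket with a fixed list, as a homomorphism of additive groups. -/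
def LieRing.leftNormedHom {L : Type*} [LieRing L] (l : List L) : L →+ L where
  toFun x := leftNormed x l
  map_zero' := by
    induction l with
    | nil => rfl
    | cons y l ih => simpa using ih
  map_add' := by
    induction l with
    | nil => simp
    | cons y l ih => intro u v; simp [add_lie, ih]

/-- The elements `x` with `[x, y₁, …, yₙ] = 0`. -/
def LieRing.annihilator {L : Type*} [LieRing L] (l : List L) : AddSubgroup L :=
  (leftNormedHom l).ker

@[simp] theorem LieRing.mem_annihilator {L : Type*} [LieRing L] {x : L} {l : List L} :
    x ∈ annihilator l ↔ leftNormed x l = 0 := Iff.rfl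

/-- The term of the language of Lie rings for the bracket. -/
def FirstOrder.Language.lieRing.bracketTerm {α : Type*} (s t : Language.lieRing.Term α) :
    Language.lieRing.Term α :=
  Language.Term.func (L := Language.lieRing) (l := 2) LieRingFunc.bracket ![s, t]

theorem FirstOrder.Language.lieRing.realize_bracketTerm {L : Type*} [LieRing L] {α : Type*}
    (s t : Language.lieRing.Term α) (v : α → L) :
    (bracketTerm s t).realize v = ⁅s.realize v, t.realize v⁆ := by
  simp only [bracketTerm, Language.Term.realize]
  rfl

theorem FirstOrder.Language.lieRing.realize_foldl {L : Type*} [LieRing L] {α : Type*}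
    (l : List α) (s : Language.lieRing.Term α) (v : α → L) :
    (l.foldl (fun u a => bracketTerm u (Language.Term.var a)) s).realize v =
      leftNormed (s.realize v) (l.map v) := by
  induction l generalizing s with
  | nil => rfl
  | cons a l ih => simp [ih, realize_bracketTerm]

variable {L : Type*} [LieRing L] {𝓛 : Language} [𝓛.Structure L]

theorem LieRing.definable_leftNormed_eq_zero
    (ι : Language.LHom Language.lieRing 𝓛) [ι.IsExpansionOn L] {α : Type*} (a : α) (l : List α) :
    (∅ : Set L).Definable 𝓛 {v : α → L | leftNormed (v a) (l.map v) = 0} := by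
  refine Set.empty_definable_iff.2
    ⟨(ι.onTerm (l.foldl (fun u a => Language.lieRing.bracketTerm u (Language.Term.var a))
      (Language.Term.var a))).equal
      (ι.onTerm (Language.Term.func (L := Language.lieRing) (l := 0) LieRingFunc.zero ![])), ?_⟩
  ext v
  simp only [Set.mem_ofPred_eq, Language.Formula.realize_equal, Language.LHom.realize_onTerm,
    Language.lieRing.realize_foldl]
  rfl

theorem FirstOrder.Language.IsStable.exists_not_ladder {M : Type*} [𝓛.Structure M]
    (h : 𝓛.IsStable M) {m n : ℕ} {s : Set (Fin m ⊕ Fin n → M)}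
    (hs : (∅ : Set M).Definable 𝓛 s) :
    ∃ k, ¬ ∃ (a : Fin k → Fin m → M) (b : Fin k → Fin n → M),
      ∀ i j, Sum.elim (a i) (b j) ∈ s ↔ i < j := by
  obtain ⟨φ, rfl⟩ := Set.empty_definable_iff.1 hs
  exact h m n φ

theorem LieRing.wellFounded_annihilator (ι : Language.LHom Language.lieRing 𝓛)
    [ι.IsExpansionOn L] (hL : 𝓛.IsStable L) (n : ℕ) :
    WellFounded fun B B' : Finset (Fin n → L) =>
      ⨅ y ∈ B, annihilator (List.ofFn y) < ⨅ y ∈ B', annihilator (List.ofFn y) := by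
  apply AddSubgroup.wellFounded_iInf_finset
  · obtain ⟨k, hk⟩ := hL.exists_not_ladder
      (definable_leftNormed_eq_zero ι (Sum.inl (0 : Fin 1)) (List.ofFn (Sum.inr : Fin n → _)))
    refine ⟨k, fun ⟨a, b, h⟩ => hk ⟨fun i _ => a i, b, fun i j => ?_⟩⟩
    rw [← h i j]
    simp [List.map_ofFn]
  · intro k
    have hdef : (∅ : Set L).Definable 𝓛 {v : Fin 1 ⊕ Fin (k * n) → L |
        ∀ r ∈ (Finset.univ : Finset (Fin k)), leftNormed (v (Sum.inl 0))
          ((List.ofFn fun i : Fin n => Sum.inr (finProdFinEquiv (r, i))).map v) = 0}ᶜ := by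
      have := Set.definable_biInter_finset (fun r : Fin k => definable_leftNormed_eq_zero (L := L)
        ι (Sum.inl (0 : Fin 1))
        (List.ofFn fun i : Fin n => Sum.inr (finProdFinEquiv (r, i)))) Finset.univ
      convert this.compl using 2
      ext v
      simp
    obtain ⟨m, hm⟩ := hL.exists_not_ladder hdef
    refine ⟨m, fun ⟨a, c, h⟩ => hm ⟨fun i _ => a i,
      fun j p => c j (finProdFinEquiv.symm p).1 (finProdFinEquiv.symm p).2, fun i j => ?_⟩⟩
    rw [← h i j]
    simp only [Set.mem_compl_iff, Set.mem_ofPred_eq, List.map_ofFn, Function.comp_def,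
      Sum.elim_inl, Sum.elim_inr, Equiv.symm_apply_apply, Finset.mem_univ, true_imp_iff,
      mem_annihilator]

/-- In a stable Lie ring, an intersection of annihilators of lists of length `n` is the
intersection of finitely many of them. -/
theorem LieRing.exists_finite_annihilator (ι : Language.LHom Language.lieRing 𝓛)
    [ι.IsExpansionOn L] (hL : 𝓛.IsStable L) {n : ℕ} {T : Set (List L)}
    (hT : ∀ l ∈ T, l.length = n) :
    ∃ B ⊆ T, B.Finite ∧ ∀ x, (∀ l ∈ B, leftNormed x l = 0) → ∀ l ∈ T, leftNormed x l = 0 := by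
  obtain ⟨B, hB, h⟩ := AddSubgroup.exists_finset_iInf_eq (wellFounded_annihilator ι hL n)
    {y | List.ofFn y ∈ T}
  refine ⟨List.ofFn '' (B : Set (Fin n → L)), ?_, B.finite_toSet.image _, fun x hx l hl => ?_⟩
  · rintro _ ⟨y, hy, rfl⟩
    exact hB hy
  · have hx' : x ∈ ⨅ y ∈ B, annihilator (List.ofFn y) := by
      simp only [AddSubgroup.mem_iInf, mem_annihilator]
      exact fun y hy => hx _ ⟨y, hy, rfl⟩
    rw [h] at hx'
    simp only [AddSubgroup.mem_iInf, mem_annihilator] at hx'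
    obtain rfl := hT l hl
    simpa [List.ofFn_get] using hx' l.get (by simpa [List.ofFn_get] using hl)

/-- In a stable Lie ring, the intersections of annihilators of lists of length `n` satisfy the
descending chain condition. -/
theorem LieRing.exists_minimal_annihilator (ι : Language.LHom Language.lieRing 𝓛)
    [ι.IsExpansionOn L] (hL : 𝓛.IsStable L) {n : ℕ} {κ : Type*} [Nonempty κ]
    (T : κ → Set (List L)) (hT : ∀ i, ∀ l ∈ T i, l.length = n) :
    ∃ i, ∀ j, (∀ x, (∀ l ∈ T j, leftNormed x l = 0) → ∀ l ∈ T i, leftNormed x l = 0) →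
      ∀ x, (∀ l ∈ T i, leftNormed x l = 0) → ∀ l ∈ T j, leftNormed x l = 0 := by
  obtain ⟨i, hi⟩ := AddSubgroup.exists_minimal_iInf (wellFounded_annihilator ι hL n)
    fun i => {y | List.ofFn y ∈ T i}
  have key : ∀ i x, x ∈ ⨅ y ∈ {y : Fin n → L | List.ofFn y ∈ T i}, annihilator (List.ofFn y) ↔
      ∀ l ∈ T i, leftNormed x l = 0 := by
    intro i x
    simp only [AddSubgroup.mem_iInf, mem_annihilator, Set.mem_ofPred_eq]
    refine ⟨fun h l hl => ?_, fun h y hy => h _ hy⟩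
    obtain rfl := hT i l hl
    simpa [List.ofFn_get] using h l.get (by simpa [List.ofFn_get] using hl)
  refine ⟨i, fun j hji x hx => ?_⟩
  by_contra hxj
  refine hi j (lt_of_le_not_ge (fun z hz => (key i z).2 (hji z ((key j z).1 hz))) fun hle => ?_)
  exact hxj ((key j x).1 (hle ((key i x).2 hx)))

end Stability

open LieRing

/-! ### Ideals acting nilpotently -/

namespace LieIdeal

variable {K L : Type*} [CommRing K] [LieRing L] [LieAlgebra K L]

/-- The ideal of all `x` with `[x, G] ⊆ N`. -/
def colon (N G : LieIdeal K L) : LieIdeal K L where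
  carrier := {x | ∀ g ∈ G, ⁅x, g⁆ ∈ N}
  add_mem' := fun {x y} hx hy g hg => by
    rw [add_lie]
    exact add_mem (hx g hg) (hy g hg)
  zero_mem' := fun g _ => by simp
  smul_mem' := fun c x hx g hg => by
    rw [smul_lie]
    exact N.smul_mem c (hx g hg)
  lie_mem := fun {x y} hy g hg => by
    rw [lie_lie]
    exact sub_mem (N.lie_mem (hy g hg)) (hy _ (G.lie_mem hg))

theorem colon_mono {N N' G G' : LieIdeal K L} (hN : N ≤ N') (hG : G' ≤ G) :
    colon N G ≤ colon N' G' := fun _ hx g hg => hN (hx g (hG hg))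

theorem le_colon (N G : LieIdeal K L) : N ≤ colon N G := fun _ hx g _ => lie_mem_left K L N _ g hx

/-- The iterated colon ideal: the ideal of all `x` with `[x, G, …, G] ⊆ N`. -/
def upper (N G : LieIdeal K L) : ℕ → LieIdeal K L
  | 0 => N
  | n + 1 => colon (upper N G n) G

@[simp] theorem upper_zero (N G : LieIdeal K L) : upper N G 0 = N := rfl

theorem upper_succ (N G : LieIdeal K L) (n : ℕ) : upper N G (n + 1) = colon (upper N G n) G := rfl

theorem mem_upper_succ {N G : LieIdeal K L} {n : ℕ} {x : L} :
    x ∈ upper N G (n + 1) ↔ ∀ g ∈ G, ⁅x, g⁆ ∈ upper N G n := Iff.rfl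

theorem upper_mono {N N' G G' : LieIdeal K L} (hN : N ≤ N') (hG : G' ≤ G) (n : ℕ) :
    upper N G n ≤ upper N' G' n := by
  induction n with
  | zero => exact hN
  | succ n ih => exact colon_mono ih hG

theorem le_upper (N G : LieIdeal K L) (n : ℕ) : N ≤ upper N G n := by
  induction n with
  | zero => exact le_rfl
  | succ n ih => exact ih.trans (le_colon _ _)

theorem upper_upper (N G : LieIdeal K L) (m n : ℕ) :
    upper (upper N G m) G n = upper N G (m + n) := by
  induction n with
  | zero => rfl
  | succ n ih => rw [upper_succ, ih, ← add_assoc, upper_succ]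

theorem mem_upper_iff_leftNormed {N G : LieIdeal K L} {n : ℕ} {x : L} :
    x ∈ upper N G n ↔ ∀ l : List L, l.length = n → (∀ g ∈ l, g ∈ G) → leftNormed x l ∈ N := by
  induction n generalizing x with
  | zero => simp +contextual [List.length_eq_zero_iff]
  | succ n ih =>
    rw [mem_upper_succ]
    constructor
    · intro h l hl hG
      obtain ⟨g, l, rfl⟩ := List.exists_cons_of_length_eq_add_one hl
      exact ih.1 (h g (hG g (by simp))) l (by simpa using hl) fun a ha => hG a (by simp [ha])
    · intro h g hg
      refine ih.2 fun l hl hG => h (g :: l) (by simp [hl]) ?_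
      simpa [hg] using hG

/-- The ideal `G` acts nilpotently on the whole Lie algebra. -/
def ActsNilpotently (G : LieIdeal K L) : Prop := ∃ n, upper ⊥ G n = ⊤

theorem ActsNilpotently.mono {G G' : LieIdeal K L} (h : ActsNilpotently G) (hG : G' ≤ G) :
    ActsNilpotently G' := by
  obtain ⟨n, hn⟩ := h
  exact ⟨n, top_le_iff.1 (hn ▸ upper_mono le_rfl hG n)⟩

theorem ActsNilpotently.exists_upper_eq_top {G : LieIdeal K L} (h : ActsNilpotently G)
    (N : LieIdeal K L) : ∃ n, upper N G n = ⊤ := by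
  obtain ⟨n, hn⟩ := h
  exact ⟨n, top_le_iff.1 (hn ▸ upper_mono bot_le le_rfl n)⟩

theorem mem_ucs_iff_mem_upper (I : LieIdeal K L) (n : ℕ) (x : I) :
    x ∈ (⊥ : LieSubmodule ℤ I I).ucs n ↔ (x : L) ∈ upper ⊥ I n := by
  induction n generalizing x with
  | zero => simp
  | succ n ih =>
    rw [LieSubmodule.ucs_succ, LieSubmodule.mem_normalizer, mem_upper_succ]
    constructor
    · intro h g hg
      rw [← lie_skew]
      exact neg_mem ((ih _).1 (h ⟨g, hg⟩))
    · intro h g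
      rw [ih]
      change ⁅(g : L), (x : L)⁆ ∈ _
      rw [← lie_skew]
      exact neg_mem (h g g.2)

/-- Since [L, I] ⊆ I, nilpotency of `I` costs only one more step on `L`. -/
theorem actsNilpotently_iff_isNilpotent (I : LieIdeal K L) :
    ActsNilpotently I ↔ LieRing.IsNilpotent I := by
  have key : LieRing.IsNilpotent I ↔ ∃ n, I ≤ upper ⊥ I n := by
    rw [LieRing.IsNilpotent, LieModule.isNilpotent_iff_exists_ucs_eq_top ℤ]
    refine exists_congr fun n => ⟨fun h x hx => ?_, fun h => ?_⟩
    · exact (mem_ucs_iff_mem_upper I n ⟨x, hx⟩).1 (h ▸ LieSubmodule.mem_top _)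
    · exact top_le_iff.1 fun x _ => (mem_ucs_iff_mem_upper I n x).2 (h x.2)
  rw [key]
  constructor
  · rintro ⟨n, hn⟩
    exact ⟨n, hn ▸ le_top⟩
  · rintro ⟨n, hn⟩
    refine ⟨n + 1, top_le_iff.1 fun x _ g hg => hn (I.lie_mem hg)⟩

/-- If `G` acts nilpotently on the factors of the upper central series of `H`, then `G` acts
nilpotently. -/
theorem ActsNilpotently.of_forall_upper_le {G H : LieIdeal K L} (hH : ActsNilpotently H)
    (h : ∀ i, ∃ t, upper ⊥ H (i + 1) ≤ upper (upper ⊥ H i) G t) : ActsNilpotently G := by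
  have key : ∀ i, ∃ t, upper ⊥ H i ≤ upper ⊥ G t := by
    intro i
    induction i with
    | zero => exact ⟨0, le_rfl⟩
    | succ i ih =>
      obtain ⟨s, hs⟩ := ih
      obtain ⟨t, ht⟩ := h i
      exact ⟨s + t, ht.trans (upper_upper ⊥ G s t ▸ upper_mono hs le_rfl t)⟩
  obtain ⟨n, hn⟩ := hH
  obtain ⟨t, ht⟩ := key n
  exact ⟨t, top_le_iff.1 (hn ▸ ht)⟩

/-- `I` kills each factor of its upper central series, so `I ⊔ J` acts there as `J` does. -/
theorem ActsNilpotently.sup {I J : LieIdeal K L} (hI : ActsNilpotently I)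
    (hJ : ActsNilpotently J) : ActsNilpotently (I ⊔ J) := by
  refine hI.of_forall_upper_le fun i => ?_
  obtain ⟨t, ht⟩ := hJ.exists_upper_eq_top (upper ⊥ I i)
  have key : ∀ m x, x ∈ upper ⊥ I (i + 1) → x ∈ upper (upper ⊥ I i) J m →
      x ∈ upper (upper ⊥ I i) (I ⊔ J) m := by
    intro m
    induction m with
    | zero => exact fun x _ hx => hx
    | succ m ih =>
      intro x hx hxJ g hg
      obtain ⟨a, ha, b, hb, rfl⟩ := (LieSubmodule.mem_sup _ _ _).1 hg
      rw [lie_add]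
      exact add_mem (le_upper _ _ m (hx a ha))
        (ih _ (lie_mem_left K L _ _ b hx) (hxJ b hb))
  exact ⟨t, fun x hx => key t x hx (ht ▸ LieSubmodule.mem_top x)⟩

/-- Let `[G, G] ⊆ H`, and let `J` have the same annihilator as `G` in each factor of the upper
central series of `H`. If `H` and `J` act nilpotently, then so does `G`. -/
theorem ActsNilpotently.of_lie_le {G H : LieIdeal K L} (hH : ActsNilpotently H)
    (hGH : ∀ g ∈ G, ∀ g' ∈ G, ⁅g, g'⁆ ∈ H)
    (hJ : ∀ i, ∃ J ≤ G, ActsNilpotently J ∧ colon (upper ⊥ H i) J ≤ colon (upper ⊥ H i) G) :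
    ActsNilpotently G := by
  refine hH.of_forall_upper_le fun i => ?_
  obtain ⟨J, hJG, hJn, hc⟩ := hJ i
  set Z := upper ⊥ H i
  obtain ⟨t, ht⟩ := hJn.exists_upper_eq_top Z
  -- Modulo `Z`, [x, g, j₁, …, jₘ] = [x, j₁, …, jₘ, g], which vanishes because [x, j₁, …, jₘ] is
  -- killed by `J`, hence by `G`.
  have swap : ∀ m x, x ∈ upper ⊥ H (i + 1) → x ∈ upper Z J (m + 1) → ∀ g ∈ G,
      ⁅x, g⁆ ∈ upper Z J m := by
    intro m
    induction m with
    | zero => exact fun x _ hx => hc hx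
    | succ m ih =>
      intro x hx hxJ g hg j hj
      have : ⁅⁅x, g⁆, j⁆ = ⁅⁅x, j⁆, g⁆ + ⁅x, ⁅g, j⁆⁆ := by
        rw [leibniz_lie x g j, ← lie_skew g ⁅x, j⁆]
        abel
      rw [this]
      exact add_mem (ih _ (lie_mem_left K L _ _ j hx) (hxJ j hj) g hg)
        (le_upper _ _ m (hx _ (hGH g hg j (hJG hj))))
  have key : ∀ m x, x ∈ upper ⊥ H (i + 1) → x ∈ upper Z J m → x ∈ upper Z G m := by
    intro m
    induction m with
    | zero => exact fun x _ hx => hx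
    | succ m ih =>
      exact fun x hx hxJ g hg => ih _ (lie_mem_left K L _ _ g hx) (swap m x hx hxJ g hg)
  exact ⟨t, fun x hx => key t x hx (ht ▸ LieSubmodule.mem_top x)⟩

end LieIdeal

open LieIdeal

/-! ### Nilpotency of the Fitting ideal -/

namespace LieAlgebra

variable {K L : Type*} [CommRing K] [LieRing L] [LieAlgebra K L]

theorem le_fittingIdeal {I : LieIdeal K L} (hI : ActsNilpotently I) : I ≤ fittingIdeal K L :=
  le_sSup ((actsNilpotently_iff_isNilpotent I).1 hI)

theorem exists_actsNilpotently_mem {x : L} (hx : x ∈ fittingIdeal K L) :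
    ∃ I : LieIdeal K L, ActsNilpotently I ∧ x ∈ I := by
  rw [fittingIdeal, ← LieSubmodule.mem_toSubmodule, LieSubmodule.sSup_toSubmodule,
    Submodule.mem_sSup_of_directed] at hx
  · obtain ⟨_, ⟨I, hI, rfl⟩, hxI⟩ := hx
    exact ⟨I, (actsNilpotently_iff_isNilpotent I).2 hI, hxI⟩
  · exact ⟨_, ⊥, (actsNilpotently_iff_isNilpotent _).1 ⟨1, by
      ext; simp [mem_upper_succ]⟩, rfl⟩
  · rintro _ ⟨I, hI, rfl⟩ _ ⟨J, hJ, rfl⟩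
    refine ⟨_, ⟨I ⊔ J, (actsNilpotently_iff_isNilpotent _).1
      (((actsNilpotently_iff_isNilpotent I).2 hI).sup
        ((actsNilpotently_iff_isNilpotent J).2 hJ)), rfl⟩, ?_, ?_⟩
    · exact (LieSubmodule.toSubmodule_le_toSubmodule _ _).2 le_sup_left
    · exact (LieSubmodule.toSubmodule_le_toSubmodule _ _).2 le_sup_right

/-- Finitely many elements of the Fitting ideal lie in a nilpotent ideal. -/
theorem exists_actsNilpotently_subset {G : LieIdeal K L} (hG : G ≤ fittingIdeal K L) {s : Set L}
    (hs : s.Finite) (hsG : s ⊆ G) : ∃ J ≤ G, ActsNilpotently J ∧ s ⊆ J := by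
  suffices ∃ J : LieIdeal K L, ActsNilpotently J ∧ s ⊆ J by
    obtain ⟨J, hJ, hsJ⟩ := this
    exact ⟨G ⊓ J, inf_le_left, hJ.mono inf_le_right, fun x hx => ⟨hsG hx, hsJ hx⟩⟩
  induction s, hs using Set.Finite.induction_on with
  | empty => exact ⟨⊥, ⟨1, by ext; simp [mem_upper_succ]⟩, Set.empty_subset _⟩
  | @insert a s _ _ ih =>
    obtain ⟨I, hI, haI⟩ := exists_actsNilpotently_mem (hG (hsG (Set.mem_insert a s)))
    obtain ⟨J, hJ, hsJ⟩ := ih ((Set.subset_insert a s).trans hsG)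
    exact ⟨I ⊔ J, hI.sup hJ, Set.insert_subset (le_sup_left (a := I) haI)
      (hsJ.trans (le_sup_right (a := I)))⟩

variable {𝓛 : Language} [𝓛.Structure L]

/-- Finitely many lists (g, h₁, …, hᵢ) determine the colon ideal of `G`, and their heads lie in one
nilpotent ideal. -/
theorem exists_colon_le (ι : Language.LHom Language.lieRing 𝓛) [ι.IsExpansionOn L]
    (hL : 𝓛.IsStable L) {G : LieIdeal K L} (hG : G ≤ fittingIdeal K L) (H : LieIdeal K L)
    (i : ℕ) :
    ∃ J ≤ G, ActsNilpotently J ∧ colon (upper ⊥ H i) J ≤ colon (upper ⊥ H i) G := by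
  obtain ⟨B, hBT, hBfin, hB⟩ := exists_finite_annihilator ι hL (n := i + 1)
    (T := {l | ∃ g ∈ G, ∃ l' : List L, l'.length = i ∧ (∀ h ∈ l', h ∈ H) ∧ l = g :: l'})
    (by rintro _ ⟨g, _, l', hl', _, rfl⟩; simp [hl'])
  obtain ⟨J, hJG, hJ, hsub⟩ := exists_actsNilpotently_subset hG
    (s := (fun l : List L => l.headD 0) '' B) (hBfin.image _) (by
      rintro _ ⟨l, hl, rfl⟩
      obtain ⟨g, hg, l', _, _, rfl⟩ := hBT hl
      exact hg)
  refine ⟨J, hJG, hJ, fun x hx g hg => mem_upper_iff_leftNormed.2 fun l hl hlH => ?_⟩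
  refine hB x (fun b hb => ?_) (g :: l) ⟨g, hg, l, hl, hlH, rfl⟩
  obtain ⟨g', hg', l', hl', hlH', rfl⟩ := hBT hb
  exact mem_upper_iff_leftNormed.1 (hx g' (hsub ⟨_, hb, rfl⟩)) l' hl' hlH'

/-- A noncentral ideal inside the second centre of a nonabelian ideal below the Fitting ideal. -/
theorem exists_ideal_le_upper_two (ι : Language.LHom Language.lieRing 𝓛) [ι.IsExpansionOn L]
    (hL : 𝓛.IsStable L) {G : LieIdeal K L} (hG : G ≤ fittingIdeal K L)
    (hab : ¬ G ≤ upper ⊥ G 1) :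
    ∃ A ≤ G, A ≤ upper ⊥ G 2 ∧ ¬ A ≤ upper ⊥ G 1 := by
  let κ := {A : LieIdeal K L // A ≤ G ∧ ¬ A ≤ upper ⊥ G 1}
  have : Nonempty κ := ⟨⟨G, le_rfl, hab⟩⟩
  -- Shrinking `A` admits more `f`, so `T A` grows and its annihilator shrinks; `A` is always
  -- annihilated by `T A`.
  let T : κ → Set (List L) := fun A =>
    {l | ∃ f g, (∀ a ∈ A.1, ∀ g ∈ G, ⁅⁅a, f⁆, g⁆ = 0) ∧ g ∈ G ∧ l = [f, g]}
  obtain ⟨⟨A, hAG, hA⟩, hmin⟩ := exists_minimal_annihilator ι hL (n := 2) T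
    (by rintro _ _ ⟨f, g, _, _, rfl⟩; rfl)
  refine ⟨A, hAG, fun a ha f hf => ?_, hA⟩
  obtain ⟨J, hJG, hJ, hfJ⟩ := exists_actsNilpotently_subset hG (Set.finite_singleton f)
    (by simpa using hf)
  -- Otherwise the nilpotent action of `J` would push all of `A` into the centraliser of `G`.
  have hB : ¬ A ⊓ colon (upper ⊥ G 1) J ≤ upper ⊥ G 1 := by
    intro hle
    obtain ⟨t, ht⟩ := hJ.exists_upper_eq_top (upper ⊥ G 1)
    have key : ∀ m, A ⊓ upper (upper ⊥ G 1) J m ≤ upper ⊥ G 1 := by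
      intro m
      induction m with
      | zero => exact inf_le_right
      | succ m ih =>
        exact fun x hx => hle ⟨hx.1, fun j hj => ih ⟨lie_mem_left K L _ _ j hx.1, hx.2 j hj⟩⟩
    exact hA fun x hx => key t ⟨hx, ht ▸ LieSubmodule.mem_top x⟩
  -- By minimality the smaller ideal has the same annihilator, and `f ∈ J` is admissible for it.
  have h := hmin ⟨A ⊓ colon (upper ⊥ G 1) J, inf_le_left.trans hAG, hB⟩ ?_ a ?_
  · intro g hg
    refine h [f, g] ⟨f, g, fun b hb g' hg' => ?_, hg, rfl⟩
    exact hb.2 f (hfJ rfl) g' hg'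
  · rintro x hx _ ⟨f', g, hf', hg, rfl⟩
    exact hx _ ⟨f', g, fun b hb => hf' b hb.1, hg, rfl⟩
  · rintro _ ⟨f', g, hf', hg, rfl⟩
    exact hf' a ha g hg

theorem actsNilpotently_fittingIdeal (ι : Language.LHom Language.lieRing 𝓛)
    [ι.IsExpansionOn L] (hL : 𝓛.IsStable L) : ActsNilpotently (fittingIdeal K L) := by
  set F := fittingIdeal K L
  by_contra hF
  let κ := {X : LieIdeal K L // ¬ ActsNilpotently (F ⊓ colon ⊥ X)}
  have : Nonempty κ := ⟨⟨⊥, fun h => hF (h.mono fun x hx => ⟨hx, fun y hy => by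
    rw [(LieSubmodule.mem_bot y).1 hy, lie_zero]
    exact zero_mem _⟩)⟩⟩
  obtain ⟨⟨X, hX⟩, hmin⟩ := exists_minimal_annihilator ι hL (n := 1)
    (fun X : κ => {l | ∃ x ∈ X.1, l = [x]}) (by rintro _ _ ⟨x, _, rfl⟩; rfl)
  set G := F ⊓ colon ⊥ X
  by_cases hab : G ≤ upper ⊥ G 1
  · exact hX ⟨2, top_le_iff.1 fun x _ g hg => hab (G.lie_mem hg)⟩
  obtain ⟨A, hAG, hA₂, hA₁⟩ := exists_ideal_le_upper_two ι hL inf_le_left hab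
  obtain ⟨a, ha, g, hg, hag⟩ : ∃ a ∈ A, ∃ g ∈ G, ⁅a, g⁆ ≠ 0 := by
    by_contra! h
    exact hA₁ fun a ha g hg => (LieSubmodule.mem_bot _).2 (h a ha g hg)
  have hH : ActsNilpotently (F ⊓ colon ⊥ (X ⊔ A)) := by
    by_contra hH
    -- Minimality would give `X ⊔ A` the same centraliser as `X`, so `g` would centralise `a`.
    have h := hmin ⟨X ⊔ A, hH⟩ ?_ g ?_ [a] ⟨a, le_sup_right (a := X) ha, rfl⟩
    · rw [leftNormed_cons, leftNormed_nil, ← lie_skew, neg_eq_zero] at h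
      exact hag h
    · rintro y hy _ ⟨x, hx, rfl⟩
      exact hy _ ⟨x, le_sup_left (a := X) hx, rfl⟩
    · rintro _ ⟨x, hx, rfl⟩
      exact hg.2 x hx
  refine hX (hH.of_lie_le ?_ fun i => exists_colon_le ι hL inf_le_left _ i)
  intro g hg g' hg'
  refine ⟨F.lie_mem hg'.1, fun y hy => ?_⟩
  obtain ⟨x, hx, b, hb, rfl⟩ := (LieSubmodule.mem_sup _ _ _).1 hy
  have hb' : ∀ u ∈ G, ∀ v ∈ G, ⁅u, ⁅v, b⁆⁆ = 0 := by
    intro u hu v hv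
    rw [← lie_skew v b, lie_neg, lie_skew]
    exact hA₂ hb v hv u hu
  rw [lie_add, lie_lie g g' b, hb' g hg g' hg', hb' g' hg' g hg, sub_zero, add_zero]
  exact (colon ⊥ X).lie_mem hg'.2 x hx

/-! ### Definability of the Fitting ideal -/

/-- The Fitting ideal is the stabiliser of its upper central series, once it is nilpotent. -/
theorem exists_mem_fittingIdeal_iff (h : ActsNilpotently (fittingIdeal K L)) :
    ∃ n, ∀ x, x ∈ fittingIdeal K L ↔ ∀ i < n,
      x ∈ colon (upper ⊥ (fittingIdeal K L) i) (upper ⊥ (fittingIdeal K L) (i + 1)) := by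
  set F := fittingIdeal K L
  obtain ⟨n, hn⟩ := h
  let E : LieIdeal K L := ⨅ i ∈ Set.Iio n, colon (upper ⊥ F i) (upper ⊥ F (i + 1))
  have hE : ∀ x, x ∈ E ↔ ∀ i < n, x ∈ colon (upper ⊥ F i) (upper ⊥ F (i + 1)) := fun x => by
    simp [E, LieSubmodule.mem_iInf]
  -- `E` lowers the series of `F` one step at a time, so it acts nilpotently and lies in `F`.
  have key : ∀ i ≤ n, upper ⊥ F i ≤ upper ⊥ E i := by
    intro i
    induction i with
    | zero => exact fun _ => le_rfl
    | succ i ih =>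
      intro hi w hw e he
      rw [← lie_skew]
      exact neg_mem (ih (by lia) ((hE e).1 he i (by lia) w hw))
  refine ⟨n, fun x => ⟨fun hx i _ w hw => ?_, fun hx => ?_⟩⟩
  · rw [← lie_skew]
    exact neg_mem (hw x hx)
  · exact le_fittingIdeal ⟨n, top_le_iff.1 (hn ▸ key n le_rfl)⟩ ((hE x).2 hx)

theorem definable₁_leftNormed_eq_zero (ι : Language.LHom Language.lieRing 𝓛)
    [ι.IsExpansionOn L] (l : List L) :
    (Set.univ : Set L).Definable 𝓛 {v : Fin 1 → L | leftNormed (v 0) l = 0} := by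
  obtain ⟨φ, hφ⟩ := Set.empty_definable_iff.1 (definable_leftNormed_eq_zero (L := L) ι
    (Sum.inr 0 : (Set.univ : Set L) ⊕ Fin 1) (l.map fun x => Sum.inl ⟨x, trivial⟩))
  refine Set.definable_iff_exists_formula_sum.2 ⟨φ, ?_⟩
  ext v
  have := Set.ext_iff.1 hφ (Sum.elim (↑) v)
  simpa [Function.comp_def] using this

theorem definable_colon_upper (ι : Language.LHom Language.lieRing 𝓛) [ι.IsExpansionOn L]
    (hL : 𝓛.IsStable L) (H W : LieIdeal K L) (i : ℕ) :
    (Set.univ : Set L).Definable 𝓛 {v : Fin 1 → L | v 0 ∈ colon (upper ⊥ H i) W} := by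
  obtain ⟨B, hBT, hBfin, hB⟩ := exists_finite_annihilator ι hL (n := i + 1)
    (T := {l | ∃ w ∈ W, ∃ l' : List L, l'.length = i ∧ (∀ h ∈ l', h ∈ H) ∧ l = w :: l'})
    (by rintro _ ⟨g, _, l', hl', _, rfl⟩; simp [hl'])
  convert Set.definable_biInter_finset (fun l => definable₁_leftNormed_eq_zero ι l)
    hBfin.toFinset using 1
  ext v
  simp only [Set.mem_ofPred_eq, Set.mem_iInter, Set.Finite.mem_toFinset]
  constructor
  · intro hv l hl
    obtain ⟨w, hw, l', hl', hlH', rfl⟩ := hBT hl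
    exact mem_upper_iff_leftNormed.1 (hv w hw) l' hl' hlH'
  · exact fun hv w hw => mem_upper_iff_leftNormed.2 fun l hl hlH =>
      hB _ hv (w :: l) ⟨w, hw, l, hl, hlH, rfl⟩

end LieAlgebra

/-- `L` is a Lie algebra over a field of characteristic zero, with a stable first-order structure
in a language `𝓛` that expands its structure of Lie ring (`𝓛` may be the language of Lie rings
itself, or may also name the multiplications by scalars, for example). -/
theorem mainTheorem10 {K L : Type*} [Field K] [CharZero K] [LieRing L] [LieAlgebra K L]
    {𝓛 : FirstOrder.Language} [𝓛.Structure L]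
    (ι : FirstOrder.Language.LHom FirstOrder.Language.lieRing 𝓛) [ι.IsExpansionOn L]
    (hL : 𝓛.IsStable L) :
    LieRing.IsNilpotent (LieAlgebra.fittingIdeal K L) ∧
      (Set.univ : Set L).Definable₁ 𝓛 (LieAlgebra.fittingIdeal K L : Set L) := by
  have hF := LieAlgebra.actsNilpotently_fittingIdeal (K := K) ι hL
  refine ⟨(actsNilpotently_iff_isNilpotent _).1 hF, ?_⟩
  obtain ⟨n, hn⟩ := LieAlgebra.exists_mem_fittingIdeal_iff hF
  rw [Set.Definable₁]
  convert Set.definable_biInter_finset (fun i => LieAlgebra.definable_colon_upper ι hL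
    (LieAlgebra.fittingIdeal K L) (upper ⊥ (LieAlgebra.fittingIdeal K L) (i + 1)) i)
    (Finset.range n) using 1
  ext v
  simpa using hn (v 0)
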